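/- Conventions. All Hilbert spaces are complex. Let $\mathbb T$ be the unit circle with normalized Lebesgue measure; identities between functions on $\mathbb T$ are understood almost everywhere. $H^\infty(\mathbb T,\mathcal B(D,E))$ is the set of essentially bounded, strongly (SOT-)measurable functions $\Phi:\mathbb T\to\mathcal B(D,E)$ such that for every $x\in D$ the negatively indexed Fourier coefficients of $\Phi(\cdot)x$ vanish; $H^2(\mathbb T,E)$ is the space of $f\in L^2(\mathbb T,E)$ whose negatively indexed Fourier coefficients vanish. Put $\breve\Phi(z)=\Phi(\bar z)$ and $\widetilde\Phi(z)=\Phi(\bar z)^*$ (the flip of $\Phi$). A function $\Delta\in H^\infty(\mathbb T,\mathcal B(D,E))$ is *inner* if $\Delta^*\Delta=I_D$, and *two-sided inner* if moreover $\Delta\Delta^*=I_E$. An inner function $\Delta$ is a *left inner divisor* of $\Phi$ if $\Phi=\Delta A$ with $A$ an operator-valued $H^\infty$ function, and a *right inner divisor* of $\Phi$ if $\Phi=B\Delta$ with $B$ an operator-valued $H^\infty$ function; it is *nontrivial* if it is not a constant unitary operator. Two functions are *left coprime* if they have no common nontrivial left inner divisor; $\Phi,\Psi$ are *right coprime* if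 $\widetilde\Phi,\widetilde\Psi$ are left coprime. $\text{left-g.c.d.}(\Phi,\Psi)$ denotes a common left inner divisor of $\Phi$ and $\Psi$ of which every common left inner divisor of $\Phi$ and $\Psi$ is a left inner divisor. For $\Phi\in L^\infty(\mathbb T,\mathcal B(D,E))$ the Hankel operator $H_\Phi:H^2(\mathbb T,D)\to H^2(\mathbb T,E)$ is $H_\Phi f=JP_-(\Phi f)$, where $P_-$ is the orthogonal projection of $L^2(\mathbb T,E)$ onto $L^2(\mathbb T,E)\ominus H^2(\mathbb T,E)$ and $(Jg)(z)=\bar z g(\bar z)$; $\Phi$ is *of bounded type* if $\ker H_\Phi^*=\Theta H^2(\mathbb T,E)$ for some two-sided inner function $\Theta$ with values in $\mathcal B(E)$. A *complementary factor* of an inner function $\Omega$ with values in $\mathcal B(D_2,D)$ is a function $\Omega_c$ with values in $\mathcal B(D_3,D)$, for some Hilbert space $D_3$, such that $[\Omega,\Omega_c]$ is an inner function with values in $\mathcal B(D_2\oplus D_3,D)$ and $\ker H_{\Omega^*}=[\Omega,\Omega_c]\,H^2(\mathbb T,D_2\oplus D_3)$. **Theorem 5.2.** Let $D,E_1,E_2$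 be Hilbert spaces with $D$ separable, and suppose that $\Phi\in H^\infty(\mathbb T,\mathcal B(D,E_1))$ and $\Psi\in H^\infty(\mathbb T,\mathcal B(D,E_2))$ are not right coprime. Let $\Delta=\text{left-g.c.d.}(\widetilde\Phi,\widetilde\Psi)$, and let $\Omega$ be a nontrivial left inner divisor of $\Delta$ which is not a constant function and for which $\breve\Omega$ is of bounded type. Let $\Omega_c$ be a complementary factor of $\Omega$. Then $\widetilde{[\Omega,\Omega_c]}$ is a common nontrivial right inner divisor of $\Phi$ and $\Psi$. -/

import Mathlib

open MeasureTheory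
open scoped ENNReal InnerProductSpace

universe u v w

noncomputable section

namespace OpHardy

/-! ### The unit circle `𝕋` with its normalized Lebesgue measure `m` -/

instance instMeasurableSpaceCircle : MeasurableSpace Circle := borel Circle

instance instBorelSpaceCircle : BorelSpace Circle := ⟨rfl⟩

/-- The normalized Lebesgue measure on the unit circle, i.e. the rotation invariant Borel
probability measure. -/
def circleMeasure : Measure Circle := Measure.haarMeasure ⊤

instance instIsHaarMeasureCircle : circleMeasure.IsHaarMeasure :=
  inferInstanceAs (Measure.haarMeasure ⊤).IsHaarMeasure

instance instIsProbabilityMeasureCircle : IsProbabilityMeasure circleMeasure :=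
  ⟨Measure.haarMeasure_self⟩

section Defs

variable {D D' E E' : Type*}
  [NormedAddCommGroup D] [InnerProductSpace ℂ D]
  [NormedAddCommGroup D'] [InnerProductSpace ℂ D']
  [NormedAddCommGroup E] [InnerProductSpace ℂ E]
  [NormedAddCommGroup E'] [InnerProductSpace ℂ E']

/-! ### Fourier coefficients, `L^∞(𝕋, 𝓑(D, E))` and `H^∞(𝕋, 𝓑(D, E))`

Operator-valued functions are genuine functions on the circle, and identities between them are
understood almost everywhere. On the circle `z⁻¹` is the complex conjugate of `z`. -/

/-- The `n`-th Fourier coefficient `∫ \bar z ^ n f(z) dm(z)` (a Bochner integral). -/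
def fourierCoef (f : Circle → E) (n : ℤ) : E :=
  ∫ z, ((z ^ (-n) : Circle) : ℂ) • f z ∂circleMeasure

/-- `Φ ∈ L^∞(𝕋, 𝓑(D, E))`: strongly (SOT) measurable and essentially bounded. -/
def MemLInf (Φ : Circle → D →L[ℂ] E) : Prop :=
  (∀ x : D, AEStronglyMeasurable (fun z => Φ z x) circleMeasure) ∧
    ∃ C : ℝ, ∀ᵐ z ∂circleMeasure, ‖Φ z‖ ≤ C

/-- `Φ ∈ H^∞(𝕋, 𝓑(D, E))`: an `L^∞` function whose negative Fourier coefficients vanish. -/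
def MemHInf (Φ : Circle → D →L[ℂ] E) : Prop :=
  MemLInf Φ ∧ ∀ n : ℤ, n < 0 → ∀ x : D, fourierCoef (fun z => Φ z x) n = 0

/-- `Φ̆(z) = Φ(\bar z)`. -/
def breve (Φ : Circle → D →L[ℂ] E) : Circle → D →L[ℂ] E := fun z => Φ z⁻¹

/-- The pointwise adjoint `Φ^*(z) = Φ(z)^*`. -/
def pointwiseAdjoint [CompleteSpace D] [CompleteSpace E] (Φ : Circle → D →L[ℂ] E) :
    Circle → E →L[ℂ] D :=
  fun z => ContinuousLinearMap.adjoint (Φ z)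

/-- The flip `Φ̃ = (Φ̆)^*`, that is `Φ̃(z) = Φ(\bar z)^*`. -/
def tilde [CompleteSpace D] [CompleteSpace E] (Φ : Circle → D →L[ℂ] E) : Circle → E →L[ℂ] D :=
  pointwiseAdjoint (breve Φ)

/-! ### Inner functions and inner divisors -/

/-- `Δ ∈ H^∞(𝕋, 𝓑(D, E))` is inner: `Δ^* Δ = I_D` almost everywhere. -/
def IsInner [CompleteSpace D] [CompleteSpace E] (Δ : Circle → D →L[ℂ] E) : Prop :=
  MemHInf Δ ∧
    ∀ᵐ z ∂circleMeasure, (ContinuousLinearMap.adjoint (Δ z)) ∘L (Δ z) = ContinuousLinearMap.id ℂ D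

/-- `Δ` is two-sided inner: `Δ^* Δ = I_D` and `Δ Δ^* = I_E` almost everywhere. -/
def IsTwoSidedInner [CompleteSpace D] [CompleteSpace E] (Δ : Circle → D →L[ℂ] E) : Prop :=
  IsInner Δ ∧
    ∀ᵐ z ∂circleMeasure, (Δ z) ∘L (ContinuousLinearMap.adjoint (Δ z)) = ContinuousLinearMap.id ℂ E

/-- The inner function `Δ ∈ H^∞(𝕋, 𝓑(D', E))` is a left inner divisor of the function `Φ` with
values in `𝓑(D, E)`: `Φ = Δ A` for some `A ∈ H^∞(𝕋, 𝓑(D, D'))`. -/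
def IsLeftInnerDivisor [CompleteSpace D'] [CompleteSpace E]
    (Δ : Circle → D' →L[ℂ] E) (Φ : Circle → D →L[ℂ] E) : Prop :=
  IsInner Δ ∧ ∃ A : Circle → D →L[ℂ] D', MemHInf A ∧
    ∀ᵐ z ∂circleMeasure, Φ z = (Δ z) ∘L (A z)

/-- The inner function `Ω ∈ H^∞(𝕋, 𝓑(D, E'))` is a right inner divisor of the function `Φ` with
values in `𝓑(D, E)`: `Φ = B Ω` for some `B ∈ H^∞(𝕋, 𝓑(E', E))`. -/
def IsRightInnerDivisor [CompleteSpace D] [CompleteSpace E']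
    (Ω : Circle → D →L[ℂ] E') (Φ : Circle → D →L[ℂ] E) : Prop :=
  IsInner Ω ∧ ∃ B : Circle → E' →L[ℂ] E, MemHInf B ∧
    ∀ᵐ z ∂circleMeasure, Φ z = (B z) ∘L (Ω z)

/-- `Δ` is a unitary operator, i.e. almost everywhere equal to one constant unitary operator.
An inner divisor is called nontrivial if it is not of this form. -/
def IsUnitaryOperator (Δ : Circle → D →L[ℂ] E) : Prop :=
  ∃ U : D ≃ₗᵢ[ℂ] E, ∀ᵐ z ∂circleMeasure, ∀ x : D, Δ z x = U x

/-- `Δ` is almost everywhere equal to a constant operator. -/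
def IsConstant (Δ : Circle → D →L[ℂ] E) : Prop :=
  ∃ T : D →L[ℂ] E, ∀ᵐ z ∂circleMeasure, Δ z = T

/-- The `1 × 2` operator matrix `[A, B] : D ⊕ D' → E`, with the Hilbert space direct sum. -/
def row (A : Circle → D →L[ℂ] E) (B : Circle → D' →L[ℂ] E) :
    Circle → WithLp 2 (D × D') →L[ℂ] E :=
  fun z => ((A z).coprod (B z)) ∘L
    (WithLp.prodContinuousLinearEquiv 2 ℂ D D' : WithLp 2 (D × D') →L[ℂ] D × D')

/-! ### The spaces `L²(𝕋, E)` and `H²(𝕋, E)` -/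

/-- `L²(𝕋, E)`. -/
abbrev L2 (E : Type*) [NormedAddCommGroup E] [InnerProductSpace ℂ E] := Lp E 2 circleMeasure

theorem continuous_coe_circle : Continuous fun z : Circle => (z : ℂ) := by fun_prop

theorem integrable_smul_L2 (f : L2 E) (n : ℤ) :
    Integrable (fun z : Circle => ((z ^ n : Circle) : ℂ) • f z) circleMeasure := by
  have hf : Integrable f circleMeasure := (Lp.memLp f).integrable (by norm_num)
  exact hf.bdd_smul (C := 1)
    (Continuous.aestronglyMeasurable (continuous_coe_circle.comp (continuous_zpow n)))
    (Filter.Eventually.of_forall fun z => le_of_eq (Circle.norm_coe _))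

/-- `H²(𝕋, E)`: the functions in `L²(𝕋, E)` whose negative Fourier coefficients vanish. -/
def H2 (E : Type*) [NormedAddCommGroup E] [InnerProductSpace ℂ E] : Submodule ℂ (L2 E) where
  carrier := {f | ∀ n : ℤ, n < 0 → fourierCoef f n = 0}
  zero_mem' := by
    intro n _
    have h : (fun z : Circle => ((z ^ (-n) : Circle) : ℂ) • (0 : L2 E) z)
        =ᵐ[circleMeasure] fun _ => 0 := by
      filter_upwards [Lp.coeFn_zero E 2 circleMeasure] with z hz
      rw [hz]; simp
    rw [fourierCoef, integral_congr_ae h, integral_zero]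
  add_mem' := by
    intro f g hf hg n hn
    have h : (fun z : Circle => ((z ^ (-n) : Circle) : ℂ) • (f + g) z)
        =ᵐ[circleMeasure] fun z => ((z ^ (-n) : Circle) : ℂ) • f z
          + ((z ^ (-n) : Circle) : ℂ) • g z := by
      filter_upwards [Lp.coeFn_add f g] with z hz
      rw [hz]; simp
    rw [fourierCoef, integral_congr_ae h,
      integral_add (integrable_smul_L2 f (-n)) (integrable_smul_L2 g (-n))]
    have h1 := hf n hn
    have h2 := hg n hn
    rw [fourierCoef] at h1 h2
    rw [h1, h2, add_zero]
  smul_mem' := by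
    intro c f hf n hn
    have h : (fun z : Circle => ((z ^ (-n) : Circle) : ℂ) • (c • f) z)
        =ᵐ[circleMeasure] fun z => c • (((z ^ (-n) : Circle) : ℂ) • f z) := by
      filter_upwards [Lp.coeFn_smul c f] with z hz
      rw [hz]; simp only [Pi.smul_apply]; rw [smul_comm]
    have h1 := hf n hn
    rw [fourierCoef] at h1
    rw [fourierCoef, integral_congr_ae h, integral_smul, h1, smul_zero]

/-- The function `z ↦ z ^ n x`. -/
def monomial (n : ℤ) (x : E) : L2 E :=
  MemLp.toLp (fun z : Circle => ((z ^ n : Circle) : ℂ) • x)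
    (MemLp.of_bound
      (Continuous.aestronglyMeasurable
        ((continuous_coe_circle.comp (continuous_zpow n)).smul continuous_const)) ‖x‖
      (Filter.Eventually.of_forall fun z => by rw [norm_smul, Circle.norm_coe, one_mul]))

theorem coeFn_monomial (n : ℤ) (x : E) :
    monomial n x =ᵐ[circleMeasure] fun z => ((z ^ n : Circle) : ℂ) • x :=
  MemLp.coeFn_toLp _

theorem inner_monomial [CompleteSpace E] (n : ℤ) (x : E) (f : L2 E) :
    ⟪monomial n x, f⟫_ℂ = ⟪x, fourierCoef f n⟫_ℂ := by
  rw [fourierCoef, ← integral_inner (integrable_smul_L2 f (-n)), L2.inner_def]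
  refine integral_congr_ae ?_
  filter_upwards [coeFn_monomial n x] with z hz
  rw [hz, inner_smul_left, inner_smul_right, zpow_neg, Circle.coe_inv_eq_conj]

theorem isClosed_H2 [CompleteSpace E] : IsClosed (H2 E : Set (L2 E)) := by
  have h : (H2 E : Set (L2 E)) = ⋂ (n : ℤ) (_ : n < 0) (x : E), {f | ⟪monomial n x, f⟫_ℂ = 0} := by
    ext f
    simp only [Set.mem_iInter, Set.mem_ofPred_eq, inner_monomial]
    constructor
    · intro hf n hn x
      rw [hf n hn, inner_zero_right]
    · intro hf n hn
      exact inner_self_eq_zero.mp (hf n hn _)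
  rw [h]
  refine isClosed_iInter fun n => isClosed_iInter fun _ => isClosed_iInter fun x => ?_
  exact isClosed_eq (by fun_prop) continuous_const

instance instCompleteSpaceH2 [CompleteSpace E] : CompleteSpace (H2 E) :=
  (isClosed_H2 (E := E)).completeSpace_coe

theorem integral_zpow_circle {k : ℤ} (hk : k ≠ 0) :
    ∫ z, ((z ^ k : Circle) : ℂ) ∂circleMeasure = 0 := by
  have hk' : (k : ℝ) ≠ 0 := by exact_mod_cast hk
  have hw : ((Circle.exp (Real.pi / k) ^ k : Circle) : ℂ) = -1 := by
    rw [← Circle.exp_intCast_mul]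
    rw [mul_div_cancel₀ _ hk']
    simp
  have h := integral_mul_left_eq_self (μ := circleMeasure)
    (fun z : Circle => ((z ^ k : Circle) : ℂ)) (Circle.exp (Real.pi / k))
  simp only [mul_zpow, Circle.coe_mul, hw] at h
  rw [integral_const_mul] at h
  linear_combination (-1 / 2 : ℂ) * h

theorem monomial_mem_H2 [CompleteSpace E] {n : ℤ} (hn : 0 ≤ n) (x : E) :
    monomial n x ∈ H2 E := by
  intro k hk
  have h : (fun z : Circle => ((z ^ (-k) : Circle) : ℂ) • monomial n x z)
      =ᵐ[circleMeasure] fun z => ((z ^ (n - k) : Circle) : ℂ) • x := by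
    filter_upwards [coeFn_monomial n x] with z hz
    rw [hz, smul_smul, ← Circle.coe_mul, ← zpow_add, neg_add_eq_sub]
  rw [fourierCoef, integral_congr_ae h, integral_smul_const, integral_zpow_circle (by omega),
    zero_smul]

/-! ### Multiplication operators and Hankel operators -/

theorem aestronglyMeasurable_apply {Φ : Circle → D →L[ℂ] E} (hΦ : MemLInf Φ) {f : Circle → D}
    (hf : AEStronglyMeasurable f circleMeasure) :
    AEStronglyMeasurable (fun z => Φ z (f z)) circleMeasure := by
  obtain ⟨g, hg, hfg⟩ := hf
  have hs : ∀ s : SimpleFunc Circle D,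
      AEStronglyMeasurable (fun z => Φ z (s z)) circleMeasure := by
    intro s
    have h : (fun z => Φ z (s z)) =
        fun z => ∑ y ∈ s.range, (s ⁻¹' {y}).indicator (fun z => Φ z y) z := by
      funext z
      rw [Finset.sum_eq_single (s z)]
      · simp
      · intro y _ hy
        exact Set.indicator_of_notMem (fun h => hy h.symm) _
      · intro h
        exact absurd (s.mem_range_self z) h
    rw [h]
    refine Finset.aestronglyMeasurable_fun_sum _ fun y _ => ?_
    exact (hΦ.1 y).indicator (s.measurableSet_fiber y)
  have hlim : AEStronglyMeasurable (fun z => Φ z (g z)) circleMeasure :=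
    aestronglyMeasurable_of_tendsto_ae Filter.atTop (fun n => hs (hg.approx n))
      (Filter.Eventually.of_forall fun z =>
        ((Φ z).continuous.tendsto _).comp (hg.tendsto_approx z))
  refine hlim.congr ?_
  filter_upwards [hfg] with z hz
  rw [hz]

theorem memLp_apply {Φ : Circle → D →L[ℂ] E} (hΦ : MemLInf Φ) (f : L2 D) :
    MemLp (fun z => Φ z (f z)) 2 circleMeasure := by
  obtain ⟨C, hC⟩ := hΦ.2
  refine MemLp.of_le_mul (c := C) (Lp.memLp f)
    (aestronglyMeasurable_apply hΦ (Lp.aestronglyMeasurable f)) ?_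
  filter_upwards [hC] with z hz
  exact (Φ z).le_of_opNorm_le hz _

/-- The multiplication operator `f ↦ Φ f` from `L²(𝕋, D)` to `L²(𝕋, E)`. -/
def mulOp (Φ : Circle → D →L[ℂ] E) (hΦ : MemLInf Φ) : L2 D →L[ℂ] L2 E :=
  LinearMap.mkContinuousOfExistsBound
    { toFun := fun f => (memLp_apply hΦ f).toLp _
      map_add' := by
        intro f g
        rw [← MemLp.toLp_add]
        refine MemLp.toLp_congr _ _ ?_
        filter_upwards [Lp.coeFn_add f g] with z hz
        rw [hz]; simp
      map_smul' := by
        intro c f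
        rw [RingHom.id_apply, ← MemLp.toLp_const_smul]
        refine MemLp.toLp_congr _ _ ?_
        filter_upwards [Lp.coeFn_smul c f] with z hz
        rw [hz]; simp }
    (by
      obtain ⟨C, hC⟩ := hΦ.2
      refine ⟨C, fun f => ?_⟩
      refine Lp.norm_le_mul_norm_of_ae_le_mul ?_
      filter_upwards [hC, MemLp.coeFn_toLp (memLp_apply hΦ f)] with z hz h2
      simp only [LinearMap.coe_mk, AddHom.coe_mk]
      rw [h2]
      exact (Φ z).le_of_opNorm_le hz _)

theorem coeFn_mulOp (Φ : Circle → D →L[ℂ] E) (hΦ : MemLInf Φ) (f : L2 D) :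
    mulOp Φ hΦ f =ᵐ[circleMeasure] fun z => Φ z (f z) :=
  MemLp.coeFn_toLp (memLp_apply hΦ f)

theorem memLInf_inv_smul (E : Type*) [NormedAddCommGroup E] [InnerProductSpace ℂ E] :
    MemLInf (fun z : Circle => ((z⁻¹ : Circle) : ℂ) • ContinuousLinearMap.id ℂ E) := by
  refine ⟨fun x => ?_, 1, Filter.Eventually.of_forall fun z => ?_⟩
  · exact Continuous.aestronglyMeasurable
      (f := fun z : Circle => ((z⁻¹ : Circle) : ℂ) • x) (by fun_prop)
  · rw [norm_smul, Circle.norm_coe, one_mul]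
    exact ContinuousLinearMap.norm_id_le

theorem measurePreserving_inv_circle :
    MeasurePreserving (fun z : Circle => z⁻¹) circleMeasure circleMeasure :=
  Measure.measurePreserving_inv circleMeasure

/-- The unitary operator `J` on `L²(𝕋, E)`, `(J g)(z) = \bar z g(\bar z)`. -/
def flipOp (E : Type*) [NormedAddCommGroup E] [InnerProductSpace ℂ E] : L2 E →L[ℂ] L2 E :=
  mulOp _ (memLInf_inv_smul E) ∘L
    (Lp.compMeasurePreservingₗᵢ ℂ (fun z : Circle => z⁻¹)
      measurePreserving_inv_circle).toContinuousLinearMap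

theorem coeFn_flipOp (g : L2 E) :
    flipOp E g =ᵐ[circleMeasure] fun z => ((z⁻¹ : Circle) : ℂ) • g z⁻¹ := by
  refine (coeFn_mulOp _ (memLInf_inv_smul E) _).trans ?_
  filter_upwards [Lp.coeFn_compMeasurePreserving g measurePreserving_inv_circle] with z hz
  exact congrArg (fun y => ((z⁻¹ : Circle) : ℂ) • y) hz

/-- The orthogonal projection `P₋` of `L²(𝕋, E)` onto `L²(𝕋, E) ⊖ H²(𝕋, E)`. -/
def projMinus (E : Type*) [NormedAddCommGroup E] [InnerProductSpace ℂ E] [CompleteSpace E] :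
    L2 E →L[ℂ] L2 E :=
  (H2 E)ᗮ.starProjection

theorem flipOp_projMinus_mem [CompleteSpace E] (g : L2 E) :
    flipOp E (projMinus E g) ∈ H2 E := by
  set u := projMinus E g with hu
  have humem : u ∈ (H2 E)ᗮ := Submodule.starProjection_apply_mem _ _
  intro n hn
  have h0 : fourierCoef u (-n - 1) = 0 := by
    refine inner_self_eq_zero (𝕜 := ℂ).mp ?_
    rw [← inner_monomial]
    exact (Submodule.mem_orthogonal _ _).mp humem _ (monomial_mem_H2 (by omega) _)
  have h : (fun z : Circle => ((z ^ (-n) : Circle) : ℂ) • flipOp E u z)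
      =ᵐ[circleMeasure] fun z => (((z⁻¹) ^ (-(-n - 1)) : Circle) : ℂ) • u z⁻¹ := by
    filter_upwards [coeFn_flipOp u] with z hz
    rw [hz, smul_smul, ← Circle.coe_mul]
    congr 2
    rw [inv_zpow', ← zpow_neg_one, ← zpow_add]
    congr 1
    ring
  rw [fourierCoef, integral_congr_ae h,
    integral_inv_eq_self (fun z : Circle => ((z ^ (-(-n - 1)) : Circle) : ℂ) • u z) circleMeasure]
  exact h0

/-- The Hankel operator `H_Φ : H²(𝕋, D) → H²(𝕋, E)`, `H_Φ f = J P₋ (Φ f)`, with symbol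
`Φ ∈ L^∞(𝕋, 𝓑(D, E))`. -/
def hankel [CompleteSpace E] (Φ : Circle → D →L[ℂ] E) (hΦ : MemLInf Φ) : H2 D →L[ℂ] H2 E :=
  ContinuousLinearMap.codRestrict
    (flipOp E ∘L projMinus E ∘L mulOp Φ hΦ ∘L (H2 D).subtypeL) (H2 E)
    (fun _ => flipOp_projMinus_mem _)

/-- The subspace `Θ H²(𝕋, D)` of `L²(𝕋, E)`. -/
def mulH2 (Θ : Circle → D →L[ℂ] E) (hΘ : MemLInf Θ) : Submodule ℂ (L2 E) :=
  (H2 D).map (mulOp Θ hΘ : L2 D →ₗ[ℂ] L2 E)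

/-- `Φ ∈ L^∞(𝕋, 𝓑(D, E))` is of bounded type: `ker (H_Φ)^* = Θ H²(𝕋, E)` for some two-sided inner
function `Θ` with values in `𝓑(E)`. -/
def IsBoundedType [CompleteSpace D] [CompleteSpace E] (Φ : Circle → D →L[ℂ] E) : Prop :=
  ∃ hΦ : MemLInf Φ, ∃ Θ : Circle → E →L[ℂ] E, ∃ hΘ : IsTwoSidedInner Θ,
    (ContinuousLinearMap.adjoint (hankel Φ hΦ)).ker.map (H2 E).subtype = mulH2 Θ hΘ.1.1.1

/-- `Ωc`, with values in `𝓑(D', E)`, is the complementary factor of the inner function `Ω` with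
values in `𝓑(D, E)`: `[Ω, Ωc]` is the inner function which represents the shift invariant subspace
`ker H_{Ω^*}`, that is `ker H_{Ω^*} = [Ω, Ωc] H²(𝕋, D ⊕ D')`. -/
def IsComplementaryFactor [CompleteSpace D] [CompleteSpace D'] [CompleteSpace E]
    (Ω : Circle → D →L[ℂ] E) (Ωc : Circle → D' →L[ℂ] E) : Prop :=
  ∃ hΩ : MemLInf (pointwiseAdjoint Ω), ∃ hrow : IsInner (row Ω Ωc),
    (hankel (pointwiseAdjoint Ω) hΩ).ker.map (H2 E).subtype = mulH2 (row Ω Ωc) hrow.1.1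

end Defs

/-! ### Coprimeness and greatest common divisors

An inner function with values in `𝓑(D', E)` is isometric almost everywhere, so `D'` is isomorphic
to a closed subspace of `E`; hence it is enough to let `D'` range over the universe of `E`. -/

section Coprime

/-- `Φ` and `Ψ` are left coprime: they have no common nontrivial left inner divisor. -/
def LeftCoprime {D₁ : Type v} {D₂ : Type w} {E : Type u}
    [NormedAddCommGroup D₁] [InnerProductSpace ℂ D₁]
    [NormedAddCommGroup D₂] [InnerProductSpace ℂ D₂]
    [NormedAddCommGroup E] [InnerProductSpace ℂ E] [CompleteSpace E]
    (Φ : Circle → D₁ →L[ℂ] E) (Ψ : Circle → D₂ →L[ℂ] E) : Prop :=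
  ∀ (D' : Type u) [NormedAddCommGroup D'] [InnerProductSpace ℂ D'] [CompleteSpace D']
    (Δ : Circle → D' →L[ℂ] E),
    IsLeftInnerDivisor Δ Φ → IsLeftInnerDivisor Δ Ψ → IsUnitaryOperator Δ

/-- `Φ` and `Ψ` are right coprime: `Φ̃` and `Ψ̃` are left coprime. -/
def RightCoprime {D : Type u} {E₁ : Type v} {E₂ : Type w}
    [NormedAddCommGroup D] [InnerProductSpace ℂ D] [CompleteSpace D]
    [NormedAddCommGroup E₁] [InnerProductSpace ℂ E₁] [CompleteSpace E₁]
    [NormedAddCommGroup E₂] [InnerProductSpace ℂ E₂] [CompleteSpace E₂]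
    (Φ : Circle → D →L[ℂ] E₁) (Ψ : Circle → D →L[ℂ] E₂) : Prop :=
  LeftCoprime (tilde Φ) (tilde Ψ)

/-- `Δ` is the greatest common left inner divisor of `Φ` and `Ψ`: a common left inner divisor which
every common left inner divisor divides from the left. -/
def IsLeftGCD {D₁ : Type v} {D₂ : Type w} {D E : Type u}
    [NormedAddCommGroup D₁] [InnerProductSpace ℂ D₁]
    [NormedAddCommGroup D₂] [InnerProductSpace ℂ D₂]
    [NormedAddCommGroup D] [InnerProductSpace ℂ D] [CompleteSpace D]
    [NormedAddCommGroup E] [InnerProductSpace ℂ E] [CompleteSpace E]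
    (Δ : Circle → D →L[ℂ] E) (Φ : Circle → D₁ →L[ℂ] E) (Ψ : Circle → D₂ →L[ℂ] E) : Prop :=
  IsLeftInnerDivisor Δ Φ ∧ IsLeftInnerDivisor Δ Ψ ∧
    ∀ (D' : Type u) [NormedAddCommGroup D'] [InnerProductSpace ℂ D'] [CompleteSpace D']
      (Θ : Circle → D' →L[ℂ] E),
      IsLeftInnerDivisor Θ Φ → IsLeftInnerDivisor Θ Ψ → IsLeftInnerDivisor Θ Δ

end Coprime

end OpHardy

end

open OpHardy

namespace OpHardy

/-! ### Separable Hilbert spaces and weak measurability -/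

section Separable

variable {E : Type*} [NormedAddCommGroup E] [InnerProductSpace ℂ E]

/-! Write `R = [Ω, Ωc]`. Since `Ω` divides the g.c.d., `tilde Φ = Ω C` with `C` in `H^∞`, so `Φ = C̃
Ω̃`. If `R` is unitary a.e., then `Φ = B R̃` with `B = Φ R̃^*`. The columns of `R` are orthonormal,
so `Ω̃ R̃^* = [I, 0]`; hence `B = [C̃, 0]`, which is analytic. This is
`isRightInnerDivisor_tilde_row`, and it applies equally to `Ψ`. If `R̃` were a constant unitary, `R`
and therefore its first column `Ω` would be constant.

What remains is that `R` is two-sided (`comp_adjoint_of_isBoundedType`), and this is where bounded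
type enters. A duality computation gives `ker (H_Ω̆)^* ⊆ ker H_{Ω^*}`
(`hankel_pointwiseAdjoint_eq_zero`), that is, `Θ H² ⊆ R H²` for a two-sided inner `Θ`. Evaluating at
constant functions, the range of the isometry `R(z)` contains that of `Θ(z)`, which is the whole
space.

Separability of `D` supplies the measurability of adjoints and lets Fourier coefficients determine
`L²` functions. -/

theorem countable_of_orthonormal [TopologicalSpace.SeparableSpace E] {ι : Type*} {b : ι → E}
    (hb : Orthonormal ℂ b) : Countable ι := by
  -- Distinct orthonormal vectors are at distance `√2 > 1`, so these balls are disjoint, and a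
  -- separable space has only countably many disjoint nonempty open sets.
  have hd : (Set.univ : Set ι).PairwiseDisjoint fun i => Metric.ball (b i) (1 / 2) := by
    intro i _ j _ hij
    refine Metric.ball_disjoint_ball ?_
    have h : ‖b i - b j‖ ^ 2 = 2 := by
      rw [norm_sub_sq (𝕜 := ℂ), hb.1 i, hb.1 j, hb.2 hij]
      norm_num
    rw [dist_eq_norm]
    nlinarith [norm_nonneg (b i - b j)]
  exact Set.countable_univ_iff.mp <| hd.countable_of_isOpen (fun _ _ => Metric.isOpen_ball)
    fun i _ => ⟨b i, Metric.mem_ball_self (by norm_num)⟩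

/-- A function with values in a separable Hilbert space is strongly measurable as soon as it is
weakly measurable. -/
theorem aestronglyMeasurable_of_inner [CompleteSpace E] [TopologicalSpace.SeparableSpace E]
    {α : Type*} [MeasurableSpace α] {μ : Measure α} {f : α → E}
    (hf : ∀ y : E, AEStronglyMeasurable (fun a => ⟪y, f a⟫_ℂ) μ) : AEStronglyMeasurable f μ := by
  obtain ⟨s, b, -⟩ := exists_hilbertBasis ℂ E
  have : Countable s := countable_of_orthonormal b.orthonormal
  -- The Hilbert basis is countable, so `atTop` on its finite subsets is countably generated and the
  -- partial sums of the expansion of `f` may be used as a limit of measurable functions.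
  refine aestronglyMeasurable_of_tendsto_ae (Filter.atTop : Filter (Finset s))
    (f := fun t a => ∑ i ∈ t, ⟪b i, f a⟫_ℂ • b i) (fun t => ?_)
    (Filter.Eventually.of_forall fun a => ?_)
  · exact Finset.aestronglyMeasurable_fun_sum _ fun i _ => (hf (b i)).smul_const (b i)
  · have h := b.hasSum_repr (f a)
    simp only [b.repr_apply_apply] at h
    exact h

end Separable

/-! ### Completeness of the characters -/

/-- Uniqueness of Haar measure: the image of the invariant probability measure is an invariant
probability measure. It carries the Fourier basis of `AddCircle` over to `Circle`. -/
theorem measurePreserving_toCircle :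
    MeasurePreserving (AddCircle.toCircle : AddCircle (1 : ℝ) → Circle)
      AddCircle.haarAddCircle circleMeasure := by
  have hm : Measurable (AddCircle.toCircle : AddCircle (1 : ℝ) → Circle) :=
    AddCircle.continuous_toCircle.measurable
  refine ⟨hm, ?_⟩
  have hp : IsProbabilityMeasure
      (Measure.map (AddCircle.toCircle : AddCircle (1 : ℝ) → Circle) AddCircle.haarAddCircle) :=
    Measure.isProbabilityMeasure_map hm.aemeasurable
  have hinv : (Measure.map (AddCircle.toCircle : AddCircle (1 : ℝ) → Circle)
      AddCircle.haarAddCircle).IsMulLeftInvariant := by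
    refine ⟨fun c => ?_⟩
    obtain ⟨a, rfl⟩ := (AddCircle.homeomorphCircle (T := 1) one_ne_zero).surjective c
    rw [AddCircle.homeomorphCircle_apply, Measure.map_map (measurable_const_mul _) hm]
    have h : (fun x => AddCircle.toCircle a * x) ∘ (AddCircle.toCircle : AddCircle (1 : ℝ) → Circle)
        = AddCircle.toCircle ∘ (fun x => a + x) := by
      funext x
      simp [AddCircle.toCircle_add]
    rw [h, ← Measure.map_map hm (measurable_const_add a), map_add_left_eq_self]
  have h := Measure.haarMeasure_unique
    (Measure.map (AddCircle.toCircle : AddCircle (1 : ℝ) → Circle) AddCircle.haarAddCircle) ⊤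
  rw [h]
  simp [circleMeasure]

theorem ae_eq_zero_of_integral_zpow_smul {f : Circle → ℂ} (hf : MemLp f 2 circleMeasure)
    (h : ∀ n : ℤ, ∫ z, ((z ^ (-n) : Circle) : ℂ) • f z ∂circleMeasure = 0) :
    f =ᵐ[circleMeasure] 0 := by
  have hg : MemLp (f ∘ (AddCircle.toCircle : AddCircle (1 : ℝ) → Circle)) 2
      AddCircle.haarAddCircle := hf.comp_measurePreserving measurePreserving_toCircle
  have h0 : hg.toLp _ = 0 := by
    refine (fourierBasis (T := (1 : ℝ))).repr.injective ?_
    rw [map_zero]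
    ext n
    rw [fourierBasis_repr, fourierCoeff_congr_ae hg.coeFn_toLp, fourierCoeff]
    have hmap := (measurePreserving_toCircle).map_eq
    have hn := h n
    rw [← hmap, integral_map measurePreserving_toCircle.measurable.aemeasurable] at hn
    · simpa [AddCircle.toCircle_zsmul, AddCircle.toCircle_neg] using hn
    · rw [hmap]
      exact (Continuous.aestronglyMeasurable
        (continuous_coe_circle.comp (continuous_zpow (-n)))).smul hf.1
  rw [← eLpNorm_eq_zero_iff hf.1 (by norm_num : (2 : ℝ≥0∞) ≠ 0),
    ← eLpNorm_comp_measurePreserving hf.1 measurePreserving_toCircle,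
    eLpNorm_eq_zero_iff hg.1 (by norm_num)]
  exact (MemLp.toLp_eq_toLp_iff hg MemLp.zero).mp (by rw [h0]; rfl)

/-! ### Vector-valued Fourier coefficients and the orthogonal complement of `H2` -/

section

variable {E : Type*} [NormedAddCommGroup E] [InnerProductSpace ℂ E] [CompleteSpace E]

theorem inner_fourierCoef {f : Circle → E} (hf : Integrable f circleMeasure) (x : E) (n : ℤ) :
    ⟪x, fourierCoef f n⟫_ℂ = ∫ z, ((z ^ (-n) : Circle) : ℂ) * ⟪x, f z⟫_ℂ ∂circleMeasure := by
  have h : Integrable (fun z : Circle => ((z ^ (-n) : Circle) : ℂ) • f z) circleMeasure :=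
    hf.bdd_smul (C := 1)
      (Continuous.aestronglyMeasurable (continuous_coe_circle.comp (continuous_zpow (-n))))
      (Filter.Eventually.of_forall fun z => le_of_eq (Circle.norm_coe _))
  rw [fourierCoef, ← integral_inner h]
  simp only [inner_smul_right]

variable [TopologicalSpace.SeparableSpace E]

/-- Pairing with a fixed vector reduces this to scalar completeness; separability then merges the
null sets belonging to the different vectors. -/
theorem eq_zero_of_fourierCoef {f : L2 E} (h : ∀ n, fourierCoef f n = 0) : f = 0 := by
  have : SecondCountableTopology E := UniformSpace.secondCountable_of_separable E
  rw [Lp.eq_zero_iff_ae_eq_zero]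
  refine ae_eq_zero_of_forall_inner (𝕜 := ℂ) fun x => ?_
  refine ae_eq_zero_of_integral_zpow_smul ((Lp.memLp f).const_inner x) fun n => ?_
  have hx := inner_fourierCoef ((Lp.memLp f).integrable (by norm_num)) x n
  rw [h n, inner_zero_right] at hx
  exact hx.symm

/-- An `L²` function whose nonnegative Fourier coefficients vanish is orthogonal to `H²`. -/
theorem mem_orthogonal_H2 {f : L2 E} (h : ∀ n : ℤ, 0 ≤ n → fourierCoef f n = 0) :
    f ∈ (H2 E)ᗮ := by
  -- The projection has no negative coefficients because it lies in `H2`, and it shares its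
  -- nonnegative ones with `f`, since the difference is orthogonal to the monomials in `H2`.
  have h0 : (H2 E).starProjection f = 0 := by
    refine eq_zero_of_fourierCoef fun n => ?_
    rcases lt_or_ge n 0 with hn | hn
    · exact (Submodule.starProjection_apply_mem (H2 E) f) n hn
    · refine ext_inner_left ℂ fun x => ?_
      have h1 := Submodule.inner_right_of_mem_orthogonal (monomial_mem_H2 hn x)
        (Submodule.sub_starProjection_mem_orthogonal (K := H2 E) f)
      rw [inner_sub_right, inner_monomial, inner_monomial, h n hn, inner_zero_right,
        zero_sub, neg_eq_zero] at h1
      rw [h1, inner_zero_right]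
  have h1 := Submodule.sub_starProjection_mem_orthogonal (K := H2 E) f
  rwa [h0, sub_zero] at h1

end

theorem ae_inv {p : Circle → Prop} (h : ∀ᵐ z ∂circleMeasure, p z) :
    ∀ᵐ z ∂circleMeasure, p z⁻¹ :=
  measurePreserving_inv_circle.quasiMeasurePreserving.ae h

section

variable {D E : Type*} [NormedAddCommGroup D] [InnerProductSpace ℂ D]
  [NormedAddCommGroup E] [InnerProductSpace ℂ E]

/-! ### Kernels of Hankel operators -/

theorem inner_flipOp (f g : L2 E) : ⟪flipOp E f, g⟫_ℂ = ⟪f, flipOp E g⟫_ℂ := by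
  rw [L2.inner_def, L2.inner_def,
    ← integral_inv_eq_self (fun z : Circle => ⟪f z, flipOp E g z⟫_ℂ) circleMeasure]
  refine integral_congr_ae ?_
  filter_upwards [coeFn_flipOp f, ae_inv (coeFn_flipOp g)] with z hf hg
  rw [hf, hg, inv_inv, inner_smul_left, inner_smul_right, Circle.coe_inv_eq_conj,
    Complex.conj_conj]

theorem fourierCoef_flipOp (f : L2 E) (n : ℤ) :
    fourierCoef (flipOp E f) n = fourierCoef f (-n - 1) := by
  rw [fourierCoef, fourierCoef,
    ← integral_inv_eq_self (fun z : Circle => ((z ^ (-(-n - 1)) : Circle) : ℂ) • f z) circleMeasure]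
  refine integral_congr_ae ?_
  filter_upwards [coeFn_flipOp f] with z hz
  rw [hz, smul_smul, ← Circle.coe_mul]
  congr 2
  rw [inv_zpow', ← zpow_neg_one, ← zpow_add]
  congr 1
  ring

variable [CompleteSpace D] [CompleteSpace E]

/-- The flip sends index `n` to `-n - 1`, exchanging nonnegative and negative frequencies. -/
theorem flipOp_mem_orthogonal_H2 [TopologicalSpace.SeparableSpace E] {f : L2 E} (hf : f ∈ H2 E) :
    flipOp E f ∈ (H2 E)ᗮ := by
  refine mem_orthogonal_H2 fun n hn => ?_
  rw [fourierCoef_flipOp]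
  exact hf _ (by omega)

/-- The inclusion `ker (H_Ω̆)^* ⊆ ker H_{Ω^*}` (these two kernels are in fact equal). -/
theorem hankel_pointwiseAdjoint_eq_zero [TopologicalSpace.SeparableSpace E]
    {Ω : Circle → D →L[ℂ] E} (h₁ : MemLInf (breve Ω)) (h₂ : MemLInf (pointwiseAdjoint Ω))
    {f : H2 E} (hf : ContinuousLinearMap.adjoint (hankel (breve Ω) h₁) f = 0) :
    hankel (pointwiseAdjoint Ω) h₂ f = 0 := by
  -- With `w = P₋(Ω^* f)`, test the hypothesis on `J w`, which lies in `H2`. Moving `J`, `P₋` and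
  -- `Ω̆` across the inner product gives `0 = ⟪w, Ω^* f⟫ = ‖w‖²`.
  set u : L2 D := mulOp (pointwiseAdjoint Ω) h₂ f with hu
  set w : L2 D := projMinus D u with hw
  have hg : flipOp D w ∈ H2 D := flipOp_projMinus_mem u
  have h0 : ⟪hankel (breve Ω) h₁ ⟨flipOp D w, hg⟩, f⟫_ℂ = 0 := by
    rw [← ContinuousLinearMap.adjoint_inner_right, hf, inner_zero_right]
  have h1 : ⟪hankel (breve Ω) h₁ ⟨flipOp D w, hg⟩, f⟫_ℂ
      = ⟪mulOp (breve Ω) h₁ (flipOp D w), flipOp E f⟫_ℂ := by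
    have e : ((hankel (breve Ω) h₁ ⟨flipOp D w, hg⟩ : H2 E) : L2 E)
        = flipOp E (projMinus E (mulOp (breve Ω) h₁ (flipOp D w))) := rfl
    rw [Submodule.coe_inner, e, inner_flipOp, projMinus,
      Submodule.inner_starProjection_left_eq_right,
      Submodule.starProjection_eq_self_iff.mpr (flipOp_mem_orthogonal_H2 f.2)]
  -- Substitute `z⁻¹` for `z`: the unimodular factors of the two flips cancel.
  have h2 : ⟪mulOp (breve Ω) h₁ (flipOp D w), flipOp E f⟫_ℂ = ⟪w, u⟫_ℂ := by
    rw [L2.inner_def, L2.inner_def,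
      ← integral_inv_eq_self (fun z : Circle => ⟪w z, u z⟫_ℂ) circleMeasure]
    refine integral_congr_ae ?_
    filter_upwards [coeFn_mulOp _ h₁ (flipOp D w), coeFn_flipOp w, coeFn_flipOp (f : L2 E),
      ae_inv (coeFn_mulOp _ h₂ (f : L2 E))] with z a1 a2 a3 a4
    rw [a1, a2, a3, hu, a4, breve, pointwiseAdjoint, ContinuousLinearMap.adjoint_inner_right,
      map_smul, inner_smul_left, inner_smul_right, ← mul_assoc, ← Circle.coe_inv_eq_conj,
      ← Circle.coe_mul, inv_mul_cancel, Circle.coe_one, one_mul]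
  have h3 : ⟪w, u⟫_ℂ = ⟪w, w⟫_ℂ := by
    have hm : w ∈ (H2 D)ᗮ := Submodule.starProjection_apply_mem _ _
    conv_lhs => rw [← Submodule.starProjection_eq_self_iff.mpr hm]
    rw [Submodule.inner_starProjection_left_eq_right]
    rfl
  have hw0 : w = 0 := by
    rw [← inner_self_eq_zero (𝕜 := ℂ), ← h3, ← h2, ← h1, h0]
  refine Subtype.ext ?_
  change flipOp D w = 0
  rw [hw0, map_zero]

/-- If `Θ H² ⊆ R H²` with `Θ` two-sided inner and `R` isometric, then `R` is unitary a.e. -/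
theorem comp_adjoint_of_mulH2_le {F : Type*} [NormedAddCommGroup F] [InnerProductSpace ℂ F]
    [CompleteSpace F] [TopologicalSpace.SeparableSpace F] {Θ : Circle → F →L[ℂ] E}
    {R : Circle → D →L[ℂ] E}
    (hΘ : IsTwoSidedInner Θ) (hR : IsInner R) (hle : mulH2 Θ hΘ.1.1.1 ≤ mulH2 R hR.1.1) :
    ∀ᵐ z ∂circleMeasure,
      (R z) ∘L (ContinuousLinearMap.adjoint (R z)) = ContinuousLinearMap.id ℂ E := by
  have hx : ∀ x : F, ∀ᵐ z ∂circleMeasure, ∃ y, R z y = Θ z x := by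
    intro x
    obtain ⟨g, -, hg⟩ := hle (Submodule.mem_map_of_mem (monomial_mem_H2 le_rfl x))
    change mulOp R _ g = mulOp Θ _ _ at hg
    have h1 := coeFn_mulOp R hR.1.1 g
    rw [hg] at h1
    filter_upwards [h1, coeFn_mulOp Θ hΘ.1.1.1 (monomial 0 x), coeFn_monomial 0 x]
      with z a1 a2 a3
    refine ⟨g z, ?_⟩
    rw [← a1, a2, a3]
    simp
  -- The null set in `hx` depends on `x`, so a countable dense family is used.
  have hall : ∀ᵐ z ∂circleMeasure, ∀ n : ℕ, ∃ y, R z y = Θ z (TopologicalSpace.denseSeq F n) :=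
    ae_all_iff.mpr fun n => hx _
  filter_upwards [hall, hΘ.2, hR.2] with z h1 h2 h3
  -- `R R^*` fixes the range of `R`. Being fixed is a closed condition, so it passes from the dense
  -- family to every `x`; surjectivity of `Θ z` then concludes.
  have h4 : ∀ x : F, R z (ContinuousLinearMap.adjoint (R z) (Θ z x)) = Θ z x := by
    intro x
    refine (TopologicalSpace.denseRange_denseSeq F).induction_on
      (p := fun x => R z (ContinuousLinearMap.adjoint (R z) (Θ z x)) = Θ z x) x
      (isClosed_eq (by fun_prop) (by fun_prop)) fun n => ?_
    obtain ⟨y, hy⟩ := h1 n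
    have h5 := DFunLike.congr_fun h3 y
    simp only [ContinuousLinearMap.comp_apply, ContinuousLinearMap.id_apply] at h5
    rw [← hy, h5]
  ext v
  have h5 := DFunLike.congr_fun h2 v
  simp only [ContinuousLinearMap.comp_apply, ContinuousLinearMap.id_apply] at h5 ⊢
  rw [← h5, h4]

/-- The inner function with range `ker H_{Ω^*}` is two-sided if `Ω̆` is of bounded type. -/
theorem comp_adjoint_of_isBoundedType {F : Type*} [NormedAddCommGroup F] [InnerProductSpace ℂ F]
    [CompleteSpace F] [TopologicalSpace.SeparableSpace E] {Ω : Circle → D →L[ℂ] E}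
    {R : Circle → F →L[ℂ] E} (hbdd : IsBoundedType (breve Ω)) (hR : IsInner R)
    (hΩ : MemLInf (pointwiseAdjoint Ω))
    (hker : (hankel (pointwiseAdjoint Ω) hΩ).ker.map (H2 E).subtype = mulH2 R hR.1.1) :
    ∀ᵐ z ∂circleMeasure,
      (R z) ∘L (ContinuousLinearMap.adjoint (R z)) = ContinuousLinearMap.id ℂ E := by
  obtain ⟨hb, Θ, hΘ, hΘker⟩ := hbdd
  refine comp_adjoint_of_mulH2_le hΘ hR ?_
  rw [← hΘker, ← hker]
  exact Submodule.map_mono fun f hf => hankel_pointwiseAdjoint_eq_zero hb hΩ hf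

end

/-! ### Operations on `H^∞` -/

section

variable {D E F : Type*} [NormedAddCommGroup D] [InnerProductSpace ℂ D]
  [NormedAddCommGroup E] [InnerProductSpace ℂ E] [NormedAddCommGroup F] [InnerProductSpace ℂ F]

theorem MemLInf.memLp {Φ : Circle → D →L[ℂ] E} (hΦ : MemLInf Φ) (x : D) :
    MemLp (fun z => Φ z x) 2 circleMeasure := by
  obtain ⟨C, hC⟩ := hΦ.2
  refine MemLp.of_bound (hΦ.1 x) (C * ‖x‖) ?_
  filter_upwards [hC] with z hz
  exact (Φ z).le_of_opNorm_le hz x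

theorem MemLInf.integrable {Φ : Circle → D →L[ℂ] E} (hΦ : MemLInf Φ) (x : D) :
    Integrable (fun z => Φ z x) circleMeasure :=
  (hΦ.memLp x).integrable (by norm_num)

theorem MemLInf.comp {A : Circle → E →L[ℂ] F} {B : Circle → D →L[ℂ] E} (hA : MemLInf A)
    (hB : MemLInf B) : MemLInf (fun z => (A z) ∘L (B z)) := by
  refine ⟨fun x => aestronglyMeasurable_apply hA (hB.1 x), ?_⟩
  obtain ⟨a, ha⟩ := hA.2
  obtain ⟨b, hb⟩ := hB.2
  refine ⟨a * b, ?_⟩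
  filter_upwards [ha, hb] with z h1 h2
  exact ((A z).opNorm_comp_le (B z)).trans
    (mul_le_mul h1 h2 (norm_nonneg _) ((norm_nonneg _).trans h1))

theorem fourierCoef_congr {f g : Circle → E} (h : f =ᵐ[circleMeasure] g) (n : ℤ) :
    fourierCoef f n = fourierCoef g n := by
  refine integral_congr_ae ?_
  filter_upwards [h] with z hz
  rw [hz]

theorem MemLInf.breve {Φ : Circle → D →L[ℂ] E} (hΦ : MemLInf Φ) : MemLInf (breve Φ) := by
  obtain ⟨C, hC⟩ := hΦ.2
  refine ⟨fun x => ?_, C, ?_⟩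
  · exact AEStronglyMeasurable.comp_measurePreserving (g := fun z => Φ z x) (hΦ.1 x)
      measurePreserving_inv_circle
  · exact ae_inv (p := fun z => ‖Φ z‖ ≤ C) hC

theorem row_apply (A : Circle → D →L[ℂ] F) (B : Circle → E →L[ℂ] F) (z : Circle)
    (v : WithLp 2 (D × E)) : row A B z v = A z v.fst + B z v.snd := rfl

variable [CompleteSpace E] [CompleteSpace F]

theorem memLInf_pointwiseAdjoint [CompleteSpace D] [TopologicalSpace.SeparableSpace D] {Φ : Circle → D →L[ℂ] E}
    (hΦ : MemLInf Φ) : MemLInf (pointwiseAdjoint Φ) := by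
  refine ⟨fun y => aestronglyMeasurable_of_inner fun x => ?_, ?_⟩
  · simp only [pointwiseAdjoint, ContinuousLinearMap.adjoint_inner_right]
    exact (hΦ.1 x).inner aestronglyMeasurable_const
  · obtain ⟨C, hC⟩ := hΦ.2
    refine ⟨C, ?_⟩
    filter_upwards [hC] with z hz
    rwa [pointwiseAdjoint, LinearIsometryEquiv.norm_map]

/-- Complex conjugate of the weak form of analyticity, suited to moving the operator to the other
side of the inner product. -/
theorem inner_fourierCoef_eq_zero {Φ : Circle → D →L[ℂ] E} (hΦ : MemHInf Φ) {n : ℤ} (hn : n < 0)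
    (x : D) (y : E) : ∫ z, ((z ^ n : Circle) : ℂ) * ⟪Φ z x, y⟫_ℂ ∂circleMeasure = 0 := by
  have h := inner_fourierCoef (hΦ.1.integrable x) y n
  rw [hΦ.2 n hn x, inner_zero_right] at h
  have h' := congrArg (starRingEnd ℂ) h
  rw [map_zero, ← integral_conj] at h'
  rw [h']
  refine integral_congr_ae (Filter.Eventually.of_forall fun z => ?_)
  simp only [map_mul, inner_conj_symm, zpow_neg, Circle.coe_inv_eq_conj, Complex.conj_conj]

theorem memHInf_comp [TopologicalSpace.SeparableSpace E] {A : Circle → E →L[ℂ] F}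
    {B : Circle → D →L[ℂ] E} (hA : MemHInf A) (hB : MemHInf B) :
    MemHInf (fun z => (A z) ∘L (B z)) := by
  refine ⟨hA.1.comp hB.1, fun n hn x => ext_inner_left ℂ fun y => ?_⟩
  rw [inner_zero_right, inner_fourierCoef ((hA.1.comp hB.1).integrable x)]
  -- The coefficient of `A B x` paired with `y` is the `L²` inner product of `z ^ n A^* y` with `B
  -- x`. For `n < 0` the former is orthogonal to `H2`, which contains the latter.
  have hk : MemLp (fun z : Circle => ((z ^ n : Circle) : ℂ) • pointwiseAdjoint A z y) 2
      circleMeasure := by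
    refine MemLp.of_le ((memLInf_pointwiseAdjoint hA.1).memLp y)
      ((Continuous.aestronglyMeasurable
        (continuous_coe_circle.comp (continuous_zpow n))).smul
          ((memLInf_pointwiseAdjoint hA.1).1 y))
      (Filter.Eventually.of_forall fun z => ?_)
    rw [norm_smul, Circle.norm_coe, one_mul]
  have hkmem : hk.toLp _ ∈ (H2 E)ᗮ := by
    refine mem_orthogonal_H2 fun j hj => ext_inner_left ℂ fun e => ?_
    rw [fourierCoef_congr hk.coeFn_toLp, inner_zero_right,
      inner_fourierCoef (hk.integrable (by norm_num)),
      ← inner_fourierCoef_eq_zero hA (n := n - j) (by omega) e y]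
    refine integral_congr_ae (Filter.Eventually.of_forall fun z => ?_)
    simp only [inner_smul_right, pointwiseAdjoint, ContinuousLinearMap.adjoint_inner_right]
    rw [← mul_assoc, ← Circle.coe_mul, ← zpow_add, neg_add_eq_sub]
  have hb : (hB.1.memLp x).toLp _ ∈ H2 E := fun j hj => by
    rw [fourierCoef_congr (hB.1.memLp x).coeFn_toLp]
    exact hB.2 j hj x
  have h0 := Submodule.inner_left_of_mem_orthogonal hb hkmem
  rw [L2.inner_def] at h0
  rw [← h0]
  refine integral_congr_ae ?_
  filter_upwards [hk.coeFn_toLp, (hB.1.memLp x).coeFn_toLp] with z h1 h2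
  rw [h1, h2, inner_smul_left, pointwiseAdjoint, ContinuousLinearMap.adjoint_inner_left, zpow_neg,
    Circle.coe_inv_eq_conj, ContinuousLinearMap.comp_apply]

variable [CompleteSpace D]

/-- The flip of an `H^∞` function is in `H^∞` as soon as it is strongly measurable. -/
theorem memHInf_tilde {Φ : Circle → D →L[ℂ] E} (hΦ : MemHInf Φ)
    (hm : ∀ y, AEStronglyMeasurable (fun z => tilde Φ z y) circleMeasure) :
    MemHInf (tilde Φ) := by
  have hL : MemLInf (tilde Φ) := by
    refine ⟨hm, ?_⟩
    obtain ⟨C, hC⟩ := hΦ.1.breve.2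
    refine ⟨C, ?_⟩
    filter_upwards [hC] with z hz
    rwa [tilde, pointwiseAdjoint, LinearIsometryEquiv.norm_map]
  refine ⟨hL, fun n hn y => ext_inner_left ℂ fun x => ?_⟩
  -- The adjoint and the inversion each reverse the sign of frequencies, so analyticity survives the
  -- flip.
  rw [inner_fourierCoef (hL.integrable y), inner_zero_right,
    ← inner_fourierCoef_eq_zero hΦ hn x y,
    ← integral_inv_eq_self (fun z : Circle => ((z ^ n : Circle) : ℂ) * ⟪Φ z x, y⟫_ℂ) circleMeasure]
  refine integral_congr_ae (Filter.Eventually.of_forall fun z => ?_)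
  simp only [tilde, pointwiseAdjoint, breve, ContinuousLinearMap.adjoint_inner_right, inv_zpow']

/-- The initial space of an inner function with separable target is separable. -/
theorem IsInner.separableSpace [TopologicalSpace.SeparableSpace E] {Δ : Circle → D →L[ℂ] E}
    (hΔ : IsInner Δ) : TopologicalSpace.SeparableSpace D := by
  obtain ⟨z, hz⟩ := hΔ.2.exists
  have hiso : Isometry (Δ z) :=
    AddMonoidHomClass.isometry_of_norm (Δ z) ((Δ z).norm_map_iff_adjoint_comp_self.mpr hz)
  have : SecondCountableTopology E := UniformSpace.secondCountable_of_separable E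
  have : SecondCountableTopology D := hiso.isEmbedding.secondCountableTopology
  infer_instance

/-- The flip of a two-sided inner function is inner. -/
theorem IsTwoSidedInner.isInner_tilde [TopologicalSpace.SeparableSpace D]
    {Δ : Circle → D →L[ℂ] E} (hΔ : IsTwoSidedInner Δ) : IsInner (tilde Δ) := by
  refine ⟨memHInf_tilde hΔ.1.1 (memLInf_pointwiseAdjoint hΔ.1.1.1.breve).1, ?_⟩
  filter_upwards [ae_inv hΔ.2] with z hz
  rwa [tilde, pointwiseAdjoint, ContinuousLinearMap.adjoint_adjoint]

end

/-! ### Right divisors from left divisors of the flip -/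

section

variable {D D₁ D₂ D₃ E : Type*}
  [NormedAddCommGroup D] [InnerProductSpace ℂ D] [CompleteSpace D]
  [NormedAddCommGroup D₁] [InnerProductSpace ℂ D₁] [CompleteSpace D₁]
  [NormedAddCommGroup D₂] [InnerProductSpace ℂ D₂] [CompleteSpace D₂]
  [NormedAddCommGroup D₃] [InnerProductSpace ℂ D₃] [CompleteSpace D₃]
  [NormedAddCommGroup E] [InnerProductSpace ℂ E]

theorem IsLeftInnerDivisor.trans [TopologicalSpace.SeparableSpace D] {Φ : Circle → E →L[ℂ] D} {Δ : Circle → D₁ →L[ℂ] D}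
    {Ω : Circle → D₂ →L[ℂ] D} (hΩ : IsLeftInnerDivisor Ω Δ) (hΔ : IsLeftInnerDivisor Δ Φ) :
    IsLeftInnerDivisor Ω Φ := by
  have := hΔ.1.separableSpace
  obtain ⟨hΩ, A, hA, hΩA⟩ := hΩ
  obtain ⟨-, B, hB, hΔB⟩ := hΔ
  refine ⟨hΩ, _, memHInf_comp hA hB, ?_⟩
  filter_upwards [hΩA, hΔB] with z h1 h2
  rw [h2, h1, ContinuousLinearMap.comp_assoc]

/-- This is the first row of `R^* R = I`, read off by testing against vectors `(a, 0)`. -/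
theorem IsInner.adjoint_apply_row {Ω : Circle → D₂ →L[ℂ] D} {Ωc : Circle → D₃ →L[ℂ] D}
    (h : IsInner (row Ω Ωc)) : ∀ᵐ z ∂circleMeasure, ∀ v : WithLp 2 (D₂ × D₃),
      ContinuousLinearMap.adjoint (Ω z) (row Ω Ωc z v) = v.fst := by
  filter_upwards [h.2] with z hz v
  refine ext_inner_left ℂ fun a => ?_
  have h1 := congrArg (fun w => ⟪WithLp.toLp 2 (a, (0 : D₃)), w⟫_ℂ) (DFunLike.congr_fun hz v)
  simp only [ContinuousLinearMap.comp_apply, ContinuousLinearMap.id_apply,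
    ContinuousLinearMap.adjoint_inner_right, WithLp.prod_inner_apply] at h1
  rw [ContinuousLinearMap.adjoint_inner_right]
  simpa [row_apply] using h1

/-- If `Ω` is a left inner divisor of `Φ̃` and `[Ω, Ωc]` is two-sided inner, then the flip of
`[Ω, Ωc]` is a right inner divisor of `Φ`. -/
theorem isRightInnerDivisor_tilde_row [CompleteSpace E] [TopologicalSpace.SeparableSpace D]
    {Φ : Circle → D →L[ℂ] E} (hΦ : MemLInf Φ)
    {Ω : Circle → D₂ →L[ℂ] D} {Ωc : Circle → D₃ →L[ℂ] D} (hΩ : IsLeftInnerDivisor Ω (tilde Φ))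
    (hR : IsTwoSidedInner (row Ω Ωc)) : IsRightInnerDivisor (tilde (row Ω Ωc)) Φ := by
  have := hR.1.separableSpace
  obtain ⟨hΩi, C, hC, hΩC⟩ := hΩ
  have hadj : ∀ᵐ z ∂circleMeasure, ∀ x, Φ z x = tilde C z (tilde Ω z x) := by
    filter_upwards [ae_inv hΩC] with z hz x
    have h := congrArg ContinuousLinearMap.adjoint hz
    rw [ContinuousLinearMap.adjoint_comp, tilde, pointwiseAdjoint,
      ContinuousLinearMap.adjoint_adjoint, breve, inv_inv] at h
    rw [h]
    rfl
  -- The quotient `B = Φ R̃^*` equals `[C̃, 0]`; its analyticity thus reduces to that of `C̃`.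
  have hB : ∀ᵐ z ∂circleMeasure, ∀ v, Φ z (row Ω Ωc z⁻¹ v) = tilde C z v.fst := by
    filter_upwards [hadj, ae_inv hR.1.adjoint_apply_row] with z h1 h2 v
    rw [h1]
    exact congrArg _ (h2 v)
  have hBL : MemLInf (fun z => Φ z ∘L row Ω Ωc z⁻¹) := hΦ.comp hR.1.1.1.breve
  have hCt : MemHInf (tilde C) := by
    -- `E` may be nonseparable, so weak measurability would not suffice for `C̃`. Its strong
    -- measurability is inherited from `B` restricted to the first summand.
    refine memHInf_tilde hC fun y => (hBL.1 (WithLp.toLp 2 (y, 0))).congr ?_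
    filter_upwards [hB] with z hz
    exact hz _
  refine ⟨hR.isInner_tilde, fun z => Φ z ∘L row Ω Ωc z⁻¹, ⟨hBL, fun n hn v => ?_⟩, ?_⟩
  · rw [← hCt.2 n hn v.fst]
    refine fourierCoef_congr ?_ n
    filter_upwards [hB] with z hz
    exact hz v
  -- Two-sidedness is essential here: `B R̃ = Φ` requires `R R^* = I`.
  · filter_upwards [ae_inv hR.2] with z hz
    rw [ContinuousLinearMap.comp_assoc]
    change Φ z = Φ z ∘L (row Ω Ωc z⁻¹ ∘L ContinuousLinearMap.adjoint (row Ω Ωc z⁻¹))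
    rw [hz, ContinuousLinearMap.comp_id]

/-- Undoing the flip makes the whole row constant, and restricting it to the first summand recovers
`Ω`. -/
theorem isConstant_of_isUnitaryOperator_tilde_row {Ω : Circle → D₂ →L[ℂ] D}
    {Ωc : Circle → D₃ →L[ℂ] D} (h : IsUnitaryOperator (tilde (row Ω Ωc))) : IsConstant Ω := by
  obtain ⟨U, hU⟩ := h
  set T := ContinuousLinearMap.adjoint
    (U.toContinuousLinearEquiv : D →L[ℂ] WithLp 2 (D₂ × D₃)) with hT
  have hrow : ∀ᵐ z ∂circleMeasure, row Ω Ωc z = T := by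
    filter_upwards [ae_inv hU] with z hz
    have h1 : ContinuousLinearMap.adjoint (row Ω Ωc z) =
        (U.toContinuousLinearEquiv : D →L[ℂ] WithLp 2 (D₂ × D₃)) := by
      ext1 x
      have h2 := hz x
      rw [tilde, pointwiseAdjoint, breve, inv_inv] at h2
      exact h2
    rw [hT, ← h1, ContinuousLinearMap.adjoint_adjoint]
  refine ⟨T ∘L ((WithLp.prodContinuousLinearEquiv 2 ℂ D₂ D₃).symm :
    D₂ × D₃ →L[ℂ] WithLp 2 (D₂ × D₃)) ∘L ContinuousLinearMap.inl ℂ D₂ D₃, ?_⟩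
  filter_upwards [hrow] with z hz
  ext1 x
  have h3 := row_apply Ω Ωc z (WithLp.toLp 2 (x, 0))
  rw [hz] at h3
  simpa using h3.symm

end

end OpHardy

theorem theorem5p2
    {D D₁ D₂ D₃ : Type u} {E₁ : Type v} {E₂ : Type w}
    [NormedAddCommGroup D] [InnerProductSpace ℂ D] [CompleteSpace D]
    [TopologicalSpace.SeparableSpace D]
    [NormedAddCommGroup D₁] [InnerProductSpace ℂ D₁] [CompleteSpace D₁]
    [NormedAddCommGroup D₂] [InnerProductSpace ℂ D₂] [CompleteSpace D₂]
    [NormedAddCommGroup D₃] [InnerProductSpace ℂ D₃] [CompleteSpace D₃]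
    [NormedAddCommGroup E₁] [InnerProductSpace ℂ E₁] [CompleteSpace E₁]
    [NormedAddCommGroup E₂] [InnerProductSpace ℂ E₂] [CompleteSpace E₂]
    (Φ : Circle → D →L[ℂ] E₁) (Ψ : Circle → D →L[ℂ] E₂)
    (hΦ : MemHInf Φ) (hΨ : MemHInf Ψ)
    (hcop : ¬ RightCoprime Φ Ψ)
    (Δ : Circle → D₁ →L[ℂ] D) (hΔ : IsLeftGCD Δ (tilde Φ) (tilde Ψ))
    (Ω : Circle → D₂ →L[ℂ] D) (hΩ : IsLeftInnerDivisor Ω Δ)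
    (hΩ_nontrivial : ¬ IsUnitaryOperator Ω) (hΩ_nonconst : ¬ IsConstant Ω)
    (hΩ_bdd : IsBoundedType (breve Ω))
    (Ωc : Circle → D₃ →L[ℂ] D) (hΩc : IsComplementaryFactor Ω Ωc) :
    IsRightInnerDivisor (tilde (row Ω Ωc)) Φ ∧
      IsRightInnerDivisor (tilde (row Ω Ωc)) Ψ ∧
      ¬ IsUnitaryOperator (tilde (row Ω Ωc)) := by
  obtain ⟨hΩadj, hrow, hker⟩ := hΩc
  have hR : IsTwoSidedInner (row Ω Ωc) :=
    ⟨hrow, comp_adjoint_of_isBoundedType hΩ_bdd hrow hΩadj hker⟩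
  exact ⟨isRightInnerDivisor_tilde_row hΦ.1 (hΩ.trans hΔ.1) hR,
    isRightInnerDivisor_tilde_row hΨ.1 (hΩ.trans hΔ.2.1) hR,
    fun h => hΩ_nonconst (isConstant_of_isUnitaryOperator_tilde_row h)⟩
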